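/- **Setting.** Let $(S,\mathscr S)$ be a complete separable metric space with its Borel $\sigma$-algebra, $\pi$ a probability measure on it, and $Q$ a Markov transition kernel such that: - (A.1) $Q$ is $\pi$-reversible, i.e. $\int_A Q(x,B)\,\pi(dx)=\int_B Q(x,A)\,\pi(dx)$ for all $A,B\in\mathscr S$ (equivalently, $Q$ is self-adjoint on $L^2(\pi)$); - (A.2) there is a probability measure $\psi$ such that, whenever $\psi(A)>0$ and $x\in S$, there is $t\ge 1$ with $Q^t(x,A)>0$; - (A.3) there are a small set $C\in\mathscr S$ (that is, for some $t\ge1$ and some non-zero measure $\nu$, $Q^t(x,A)\ge \nu(A)$ for all $x\in C$, $A\in\mathscr S$), constants $\beta>0$, $b<\infty$ and a measurable $V:S\to[1,\infty)$ with $QV(x)-V(x)\le-\beta V(x)+b\,I_C(x)$ for all $x$; - (A.4) $Q$ is aperiodic: there are no $d\ge2$ and disjoint $D_1,\dots,D_d\in\mathscr S$ with $Q(x,D_{i+1})=1$ for $x\in D_i$ (where $D_{d+1}=D_1$) and $\psi((\bigcup_i D_i)^c)=0$. Let $X_0,X_1,\dots$ be a Markov chain with transition kernel $Q$ and arbitrary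 initial distribution, and let $g:S\to\mathbb R$ satisfy $\int g^2\,d\pi<\infty$. Let $\gamma(k)=\mathrm{Cov}_\pi(g(X_0),g(X_{|k|}))$, $k\in\mathbb Z$, be the autocovariance sequence of the stationary chain, that is, the covariance of $g(x)$ and $g(y)$ under $\pi(dx)\,Q^{|k|}(x,dy)$. A finite measure $F$ on $\mathbb R$ with support in a compact interval *represents* $m\in\mathbb R^{\mathbb Z}$ if $m(k)=\int x^{|k|}F(dx)$ for all $k\in\mathbb Z$. Let $\delta>0$ be such that the representing measure $F$ of $\gamma$ has support contained in $[-1+\delta,1-\delta]$. Let $\mathscr M_\infty(\delta)$ be the set of sequences represented by some finite measure with support in $[-1+\delta,1-\delta]$, and for $r\in\ell_2(\mathbb Z)$ let $$\Pi_\delta(r)=\arg\min_{m\in\mathscr M_\infty(\delta)\cap\ell_2(\mathbb Z)}\ \sum_{k\in\mathbb Z}(r(k)-m(k))^2 .$$ For each $M$ let $r^{\rm init}_M$ be a sequence on $\mathbb Z$ computed from the sample $X_0,\dots,X_{M-1}$, such that - (R.1) for each $k\in\mathbb Z$, $r^{\rm init}_M(k)\to\gamma(k)$ almost surely as $M\to\infty$;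 - (R.2) $r^{\rm init}_M(k)=0$ for all $k\ge n(M)$, for some finite $n(M)$ (which may depend on the sample); - (R.3) $r^{\rm init}_M(k)=r^{\rm init}_M(-k)$ and $r^{\rm init}_M(0)\ge|r^{\rm init}_M(k)|$ for all $k\in\mathbb Z$. **Theorem (strong consistency of the asymptotic variance estimator).** The sequences $\gamma$ and $\Pi_\delta(r^{\rm init}_M)$, for every $M$, are summable, and, with $\sigma^2(m)=\sum_{k\in\mathbb Z}m(k)$, $$\sigma^2(\Pi_\delta(r^{\rm init}_M))\longrightarrow\sigma^2(\gamma)\qquad\text{almost surely as }M\to\infty .$$ -/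

import Mathlib

open MeasureTheory ProbabilityTheory Filter
open scoped Topology

namespace MomentLSE

section MarkovChains

variable {S : Type*} [MeasurableSpace S]

/-- The kernel `Q` is `ψ`-irreducible: from every point, every measurable set of positive
`ψ`-measure is reached with positive probability after some positive number of steps. -/
def IsPsiIrreducible (ψ : Measure S) (Q : Kernel S S) : Prop :=
  ∀ A : Set S, MeasurableSet A → 0 < ψ A → ∀ x : S, ∃ t : ℕ, 0 < t ∧ 0 < (Q ^ t) x A

/-- A measurable set `C` is small with respect to `Q`: some power of `Q` has, on `C`, a common
nontrivial minorizing measure. -/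
def IsSmall (Q : Kernel S S) (C : Set S) : Prop :=
  MeasurableSet C ∧ ∃ (t : ℕ) (ν : Measure S), 0 < t ∧ ν ≠ 0 ∧
    ∀ x ∈ C, ∀ A : Set S, MeasurableSet A → ν A ≤ (Q ^ t) x A

/-- The geometric drift condition `QV - V ≤ -β V + b 1_C`, with `C` small, `β > 0`, `b < ∞` and
`V : S → [1, ∞)`. The finiteness of `QV` is part of the condition. -/
def GeometricDrift (Q : Kernel S S) : Prop :=
  ∃ (C : Set S) (β b : ℝ) (V : S → ℝ), IsSmall Q C ∧ 0 < β ∧ Measurable V ∧ (∀ x, 1 ≤ V x) ∧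
    ∀ x, Integrable V (Q x) ∧
      (∫ y, V y ∂(Q x)) - V x ≤ -β * V x + b * C.indicator (fun _ => (1 : ℝ)) x

/-- Aperiodicity of a `ψ`-irreducible kernel: there is no `d`-cycle with `d ≥ 2`, that is, no
disjoint measurable sets `D i`, indexed cyclically, with `Q x (D (i + 1)) = 1` for `x ∈ D i`, that
cover the space up to a `ψ`-null set. -/
def IsAperiodic (ψ : Measure S) (Q : Kernel S S) : Prop :=
  ∀ d : ℕ, 2 ≤ d → ¬ ∃ D : ZMod d → Set S,
    (∀ i, MeasurableSet (D i)) ∧ Pairwise (fun i j => Disjoint (D i) (D j)) ∧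
      (∀ i, ∀ x ∈ D i, Q x (D (i + 1)) = 1) ∧ ψ (⋃ i, D i)ᶜ = 0

/-- `X 0, X 1, …` is a Markov chain with transition kernel `Q`, with an arbitrary initial law:
the conditional probability of `X (t + 1) ∈ A` given `X 0, …, X t` is `Q (X t) A`. -/
def IsMarkovChain {Ω : Type*} [MeasurableSpace Ω] (P : Measure Ω) (Q : Kernel S S)
    (X : ℕ → Ω → S) : Prop :=
  (∀ t, Measurable (X t)) ∧
    ∀ (t : ℕ) (A : Set S), MeasurableSet A →
      P[(X (t + 1) ⁻¹' A).indicator (fun _ => (1 : ℝ)) |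
          ⨆ s ∈ Set.Iic t, MeasurableSpace.comap (X s) inferInstance]
        =ᵐ[P] fun ω => (Q (X t ω)).real A

/-- The lag-`k` autocovariance `Cov_π(g(X_0), g(X_{|k|}))` of the stationary chain: the pair
`(X_0, X_{|k|})` has the law `π(dx) Q^{|k|}(x, dy)`. -/
noncomputable def autocov (Q : Kernel S S) (π : Measure S) (g : S → ℝ) (k : ℤ) : ℝ :=
  cov[fun p : S × S => g p.1, fun p : S × S => g p.2; π ⊗ₘ (Q ^ k.natAbs)]

/-- The conditions on an initial autocovariance estimator. Here `r M z k` is the estimate at lag `k`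
computed from the sample `z = (z_0, …, z_{M-1})` of size `M`. -/
structure IsInitialEstimator {Ω : Type*} [MeasurableSpace Ω] (P : Measure Ω) (X : ℕ → Ω → S)
    (γ : ℤ → ℝ) (r : (M : ℕ) → (Fin M → S) → ℤ → ℝ) : Prop where
  tendsto_ae : ∀ k : ℤ, ∀ᵐ ω ∂P,
    Tendsto (fun M : ℕ => r M (fun i => X i ω) k) atTop (𝓝 (γ k))
  finite_support : ∀ (M : ℕ) (z : Fin M → S), ∃ n : ℕ, ∀ k : ℤ, (n : ℤ) ≤ k → r M z k = 0
  even : ∀ (M : ℕ) (z : Fin M → S) (k : ℤ), r M z k = r M z (-k)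
  peak : ∀ (M : ℕ) (z : Fin M → S) (k : ℤ), |r M z k| ≤ r M z 0

end MarkovChains

section MomentSequences

/-- `F` is a finite measure on `ℝ`, supported in `[a, b]`, that represents the sequence `m`:
`m k = ∫ x ^ |k| dF` for all `k`. (Finite Borel measures on `ℝ` are automatically regular.) -/
structure IsRepresentingMeasure (a b : ℝ) (m : ℤ → ℝ) (F : Measure ℝ) : Prop where
  finite : IsFiniteMeasure F
  support_subset : F.support ⊆ Set.Icc a b
  moment : ∀ k : ℤ, m k = ∫ x, x ^ k.natAbs ∂F

/-- The space `𝓜_∞([a, b])` of `[a, b]`-moment sequences on `ℤ`. -/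
def momentSpace (a b : ℝ) : Set (ℤ → ℝ) :=
  {m | ∃ F : Measure ℝ, IsRepresentingMeasure a b m F}

/-- The set `𝓜_∞(δ) ∩ ℓ₂(ℤ)`. -/
def momentSpaceL2 (δ : ℝ) : Set (ℤ → ℝ) :=
  {m | m ∈ momentSpace (-1 + δ) (1 - δ) ∧ Summable fun k => m k ^ 2}

/-- `m` is a least squares projection of `r` onto `𝓜_∞(δ) ∩ ℓ₂(ℤ)`. -/
def IsProjection (δ : ℝ) (r m : ℤ → ℝ) : Prop :=
  m ∈ momentSpaceL2 δ ∧ IsMinOn (fun m' : ℤ → ℝ => ∑' k, (r k - m' k) ^ 2) (momentSpaceL2 δ) m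

/-- The moment least squares estimator `Π_δ(r)`: the minimizer of `∑ (r k - m k) ^ 2` over
`m ∈ 𝓜_∞(δ) ∩ ℓ₂(ℤ)` (an unspecified sequence if there were no minimizer). -/
noncomputable def momentLSE (δ : ℝ) (r : ℤ → ℝ) : ℤ → ℝ :=
  Classical.epsilon (IsProjection δ r)

/-- The asymptotic variance functional `σ²(m) = ∑_{k ∈ ℤ} m k`. -/
noncomputable def asympVar (m : ℤ → ℝ) : ℝ := ∑' k : ℤ, m k

end MomentSequences

end MomentLSE

/-! Reversibility makes the Markov operator `T` of `Q` a self-adjoint contraction on `L²(π)`, and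
with `g₀ = g - ∫ g dπ` the autocovariance is `⟪g₀, T^|k| g₀⟫`, a moment sequence on `[-1, 1]`
(`autocov_mem_momentSpace`). The choice of `δ` confines its measure to `[-1 + δ, 1 - δ]`. There all
moment sequences satisfy `|m k| ≤ m 0 * w k` with one summable `w` (`exists_summable_bound`).

Let `m_M` be the projection of `r_M` onto this closed convex set. Testing its variational inequality
at `0` bounds `m_M 0` by `r_M 0 * ∑ w`, hence dominates all `m_M` eventually. Testing at `γ` gives
`‖m_M - γ‖² ≤ ⟪r_M - γ, m_M - γ⟫`. The first factor is bounded and tends to `0` pointwise, the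
second is dominated, so the pairing tends to `0` although `r_M` need not converge in `ℓ²`. Thus `m_M
→ γ` pointwise, and domination gives convergence of the sums (`tendsto_asympVar_of_isProjection`).

Closedness, convexity and the spectral representation all rest on `mem_momentSpace_iff`: being a
moment sequence amounts to evenness and positivity on polynomials. -/

namespace MomentLSE

/-! ### Moment sequences as positive functionals on polynomials. -/

section HausdorffMoment

open Polynomial

/-- A positive linear functional on `C([a, b])` is integration against a finite measure on `ℝ`
supported in `[a, b]`. -/
theorem exists_measure_of_nonneg_continuousMap (a b : ℝ) (Λ : C(Set.Icc a b, ℝ) →ₗ[ℝ] ℝ)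
    (hΛ : ∀ f : C(Set.Icc a b, ℝ), (∀ x, 0 ≤ f x) → 0 ≤ Λ f) :
    ∃ F : Measure ℝ, IsFiniteMeasure F ∧ F.support ⊆ Set.Icc a b ∧
      ∀ f : C(ℝ, ℝ), Λ (f.restrict (Set.Icc a b)) = ∫ x, f x ∂F := by
  let Λ' : CompactlySupportedContinuousMap (Set.Icc a b) ℝ →ₚ[ℝ] ℝ :=
    PositiveLinearMap.mk₀
      { toFun := fun f => Λ f.toContinuousMap
        map_add' := fun f g => by rw [← map_add]; rfl
        map_smul' := fun c f => by rw [RingHom.id_apply, ← map_smul]; rfl }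
      (fun f hf => hΛ _ fun x => hf x)
  let μ := RealRMK.rieszMeasure Λ'
  have : IsFiniteMeasure μ := ⟨isCompact_univ.measure_lt_top⟩
  have hemb : MeasurableEmbedding ((↑) : Set.Icc a b → ℝ) :=
    MeasurableEmbedding.subtype_coe measurableSet_Icc
  refine ⟨μ.map (↑), inferInstance, ?_, fun f => ?_⟩
  · refine Measure.support_subset_of_isClosed isClosed_Icc ?_
    rw [mem_ae_iff, hemb.map_apply]
    convert measure_empty (μ := μ)
    ext x
    simp
  · rw [hemb.integral_map]
    exact (RealRMK.integral_rieszMeasure Λ'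
      (CompactlySupportedContinuousMap.continuousMapEquiv (f.restrict (Set.Icc a b)))).symm

/-- A linear functional on polynomials which is nonnegative on the polynomials that are
nonnegative on `[a, b]` is integration against a finite measure supported in `[a, b]`. -/
theorem exists_measure_of_nonneg_polynomial (a b : ℝ) (L : ℝ[X] →ₗ[ℝ] ℝ)
    (hL : ∀ p : ℝ[X], (∀ x ∈ Set.Icc a b, 0 ≤ p.eval x) → 0 ≤ L p) :
    ∃ F : Measure ℝ, IsFiniteMeasure F ∧ F.support ⊆ Set.Icc a b ∧
      ∀ p : ℝ[X], L p = ∫ x, p.eval x ∂F := by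
  let Φ : ℝ[X] →ₗ[ℝ] C(Set.Icc a b, ℝ) :=
    (Polynomial.toContinuousMapOnAlgHom (R := ℝ) (Set.Icc a b)).toLinearMap
  have hΦ : ∀ p x, Φ p x = p.eval (x : ℝ) := fun p x => rfl
  -- If `p` vanishes on `[a, b]`, both `p` and `-p` are nonnegative there. This is needed because
  -- restriction is not injective when `a ≥ b`.
  have hker : LinearMap.ker Φ ≤ LinearMap.ker L := by
    intro p hp
    have hp' : ∀ x ∈ Set.Icc a b, p.eval x = 0 := fun x hx => by
      rw [← hΦ p ⟨x, hx⟩, LinearMap.mem_ker.1 hp]; rfl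
    have h1 := hL p fun x hx => (hp' x hx).ge
    have h2 := hL (-p) fun x hx => by simp [hp' x hx]
    rw [map_neg] at h2
    exact LinearMap.mem_ker.2 (by linarith)
  let f : C(Set.Icc a b, ℝ) →ₗ.[ℝ] ℝ :=
    ⟨LinearMap.range Φ, (LinearMap.ker Φ).liftQ L hker ∘ₗ Φ.quotKerEquivRange.symm⟩
  have hf : ∀ p (h : Φ p ∈ LinearMap.range Φ), f ⟨Φ p, h⟩ = L p := by
    intro p h
    change (LinearMap.ker Φ).liftQ L hker (Φ.quotKerEquivRange.symm ⟨Φ p, h⟩) = L p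
    rw [Φ.quotKerEquivRange_symm_apply_image]
    simp
  let s : PointedCone ℝ C(Set.Icc a b, ℝ) :=
    { carrier := {g | ∀ x, 0 ≤ g x}
      add_mem' := fun {u v} hu hv x => add_nonneg (hu x) (hv x)
      zero_mem' := fun x => le_rfl
      smul_mem' := fun c u hu x => mul_nonneg c.2 (hu x) }
  obtain ⟨Λ, hΛf, hΛs⟩ := riesz_extension s f (by
    rintro ⟨_, p, rfl⟩ hp
    exact (hL p fun x hx => hp ⟨x, hx⟩).trans_eq (hf p _).symm) (by
    intro g
    -- Constants dominate every continuous function on `[a, b]`: the cofinality required by the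
    -- Riesz extension theorem.
    refine ⟨⟨Φ (C ‖g‖), LinearMap.mem_range_self _ _⟩, fun x => ?_⟩
    have := neg_le_of_abs_le (g.norm_coe_le_norm x)
    rw [ContinuousMap.add_apply, hΦ, eval_C]
    linarith)
  obtain ⟨F, hfin, hsupp, hF⟩ := exists_measure_of_nonneg_continuousMap a b Λ hΛs
  refine ⟨F, hfin, hsupp, fun p => ?_⟩
  rw [← hf p (LinearMap.mem_range_self _ _), ← hΛf]
  exact hF ⟨fun x => p.eval x, p.continuous⟩

theorem ae_mem_Icc_of_support_subset {F : Measure ℝ} {a b : ℝ} (h : F.support ⊆ Set.Icc a b) :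
    ∀ᵐ x ∂F, x ∈ Set.Icc a b :=
  Filter.mem_of_superset Measure.support_mem_ae h

theorem integrable_continuous_of_support_subset {F : Measure ℝ} [IsFiniteMeasure F] {a b : ℝ}
    (h : F.support ⊆ Set.Icc a b) {f : ℝ → ℝ} (hf : Continuous f) : Integrable f F := by
  obtain ⟨C, hC⟩ := isCompact_Icc.exists_bound_of_continuousOn (hf.continuousOn (s := Set.Icc a b))
  exact Integrable.of_bound hf.aestronglyMeasurable C
    ((ae_mem_Icc_of_support_subset h).mono fun x hx => hC x hx)

/-- The linear functional on polynomials with `X ^ n ↦ m n`. -/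
noncomputable def momentFunctional (m : ℤ → ℝ) : ℝ[X] →ₗ[ℝ] ℝ :=
  Polynomial.lsum fun n => m n • LinearMap.id

theorem momentFunctional_apply (m : ℤ → ℝ) (p : ℝ[X]) :
    momentFunctional m p = ∑ n ∈ p.support, m n * p.coeff n := by
  simp [momentFunctional, Polynomial.lsum_apply, Polynomial.sum_def]

theorem momentFunctional_X_pow (m : ℤ → ℝ) (n : ℕ) : momentFunctional m (X ^ n) = m n := by
  simp [momentFunctional, Polynomial.lsum_apply,
    ← Polynomial.monomial_one_right_eq_X_pow, Polynomial.sum_monomial_index]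

theorem IsRepresentingMeasure.momentFunctional_eq {a b : ℝ} {m : ℤ → ℝ} {F : Measure ℝ}
    (h : IsRepresentingMeasure a b m F) (p : ℝ[X]) :
    momentFunctional m p = ∫ x, p.eval x ∂F := by
  have := h.finite
  rw [momentFunctional_apply]
  simp only [eval_eq_sum, Polynomial.sum_def]
  rw [integral_finsetSum _ fun n _ =>
    integrable_continuous_of_support_subset h.support_subset (by fun_prop)]
  refine Finset.sum_congr rfl fun n _ => ?_
  rw [integral_const_mul, h.moment, Int.natAbs_natCast, mul_comm]

/-- A sequence is a moment sequence on `[a, b]` iff it is even and its moment functional is positive. -/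
theorem mem_momentSpace_iff {a b : ℝ} {m : ℤ → ℝ} :
    m ∈ momentSpace a b ↔ (∀ k : ℤ, m k = m k.natAbs) ∧
      ∀ p : ℝ[X], (∀ x ∈ Set.Icc a b, 0 ≤ p.eval x) → 0 ≤ momentFunctional m p := by
  constructor
  · rintro ⟨F, hF⟩
    refine ⟨fun k => by rw [hF.moment, hF.moment, Int.natAbs_natCast], fun p hp => ?_⟩
    rw [hF.momentFunctional_eq]
    exact integral_nonneg_of_ae ((ae_mem_Icc_of_support_subset hF.support_subset).mono hp)
  · rintro ⟨heven, hpos⟩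
    obtain ⟨F, hfin, hsupp, hF⟩ := exists_measure_of_nonneg_polynomial a b _ hpos
    refine ⟨F, hfin, hsupp, fun k => ?_⟩
    rw [heven, ← momentFunctional_X_pow m, hF]
    simp

/-- Positivity on a fixed polynomial involves finitely many terms, so it survives pointwise limits
without any compactness of the measures. -/
theorem mem_momentSpace_of_tendsto {ι : Type*} {l : Filter ι} [l.NeBot] {a b : ℝ}
    {u : ι → ℤ → ℝ} {m : ℤ → ℝ} (hu : ∀ i, u i ∈ momentSpace a b)
    (hm : ∀ k, Tendsto (fun i => u i k) l (𝓝 (m k))) : m ∈ momentSpace a b := by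
  simp only [mem_momentSpace_iff] at hu ⊢
  refine ⟨fun k => ?_, fun p hp => ?_⟩
  · refine tendsto_nhds_unique (hm k) ?_
    simp only [fun i => (hu i).1 k]
    exact hm _
  · refine ge_of_tendsto' (f := fun i => momentFunctional (u i) p) (x := l) ?_
      fun i => (hu i).2 p hp
    simp only [momentFunctional_apply]
    exact tendsto_finsetSum _ fun n _ => (hm n).mul_const _

theorem zero_mem_momentSpace (a b : ℝ) : (0 : ℤ → ℝ) ∈ momentSpace a b := by
  rw [mem_momentSpace_iff]
  simp [momentFunctional_apply]

theorem convex_momentSpace (a b : ℝ) : Convex ℝ (momentSpace a b) := by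
  intro u hu v hv s t hs ht _
  rw [mem_momentSpace_iff] at hu hv ⊢
  refine ⟨fun k => ?_, fun p hp => ?_⟩
  · simp [hu.1 k, hv.1 k]
  · have : momentFunctional (s • u + t • v) p
        = s * momentFunctional u p + t * momentFunctional v p := by
      simp only [momentFunctional_apply, Finset.mul_sum, ← Finset.sum_add_distrib]
      refine Finset.sum_congr rfl fun n _ => ?_
      simp only [Pi.add_apply, Pi.smul_apply, smul_eq_mul]
      ring
    rw [this]
    exact add_nonneg (mul_nonneg hs (hu.2 p hp)) (mul_nonneg ht (hv.2 p hp))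

/-- Moment sequences on `[-1 + δ, 1 - δ]` decay geometrically. -/
theorem abs_le_of_mem_momentSpace {δ : ℝ} {m : ℤ → ℝ}
    (hm : m ∈ momentSpace (-1 + δ) (1 - δ)) (k : ℤ) :
    |m k| ≤ m 0 * |1 - δ| ^ k.natAbs := by
  obtain ⟨F, hF⟩ := hm
  have := hF.finite
  rw [hF.moment, hF.moment 0, ← integral_mul_const]
  refine (abs_integral_le_integral_abs).trans (integral_mono_ae ?_ ?_ ?_)
  · exact integrable_continuous_of_support_subset hF.support_subset (by fun_prop)
  · exact integrable_continuous_of_support_subset hF.support_subset (by fun_prop)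
  · filter_upwards [ae_mem_Icc_of_support_subset hF.support_subset] with x hx
    simp only [Int.natAbs_zero, pow_zero, one_mul, abs_pow]
    refine pow_le_pow_left₀ (abs_nonneg _) ?_ _
    exact (abs_le.2 ⟨by linarith [hx.1], hx.2⟩).trans (le_abs_self _)

theorem zero_le_of_mem_momentSpace {a b : ℝ} {m : ℤ → ℝ} (hm : m ∈ momentSpace a b) :
    0 ≤ m 0 := by
  obtain ⟨F, hF⟩ := hm
  rw [hF.moment]
  simp

/-- If `1 < δ` then `[-1 + δ, 1 - δ]` is empty and only the zero sequence is represented. -/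
theorem eq_zero_of_mem_momentSpace {δ : ℝ} (hδ : 1 < δ) {m : ℤ → ℝ}
    (hm : m ∈ momentSpace (-1 + δ) (1 - δ)) : m = 0 := by
  obtain ⟨F, hF⟩ := hm
  have h := ae_mem_Icc_of_support_subset hF.support_subset
  rw [Set.Icc_eq_empty (by linarith)] at h
  have : F = 0 := by simpa using h
  funext k
  simp [hF.moment, this]

end HausdorffMoment

/-! ### Spectral representation of the autocovariances. -/

section SpectralRepresentation

open Polynomial ContinuousLinearMap

/-- The spectrum of `T` lies in `[-1, 1]`, so the functional calculus makes `p(T)` a positive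
operator. -/
theorem re_inner_aeval_nonneg {E : Type*} [NormedAddCommGroup E] [InnerProductSpace ℂ E]
    [CompleteSpace E] (T : E →L[ℂ] E) (hT : IsSelfAdjoint T) (hT1 : ‖T‖ ≤ 1)
    (p : ℝ[X]) (hp : ∀ x ∈ Set.Icc (-1 : ℝ) 1, 0 ≤ p.eval x) (x : E) :
    0 ≤ (inner ℂ x (aeval T p x)).re := by
  have h : 0 ≤ aeval T p := by
    rw [← cfc_polynomial p T hT]
    refine cfc_nonneg fun x hx => hp x (abs_le.1 ?_)
    rcases subsingleton_or_nontrivial E with hE | hE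
    · simp [spectrum.of_subsingleton] at hx
    · exact (spectrum.norm_le_norm_of_mem hx).trans hT1
  rw [ContinuousLinearMap.nonneg_iff_isPositive] at h
  exact h.re_inner_nonneg_right x

/-- Matrix coefficients of the powers of a selfadjoint contraction are a moment sequence on
`[-1, 1]`. -/
theorem mem_momentSpace_of_inner_pow {E : Type*} [NormedAddCommGroup E] [InnerProductSpace ℂ E]
    [CompleteSpace E] (T : E →L[ℂ] E) (hT : IsSelfAdjoint T) (hT1 : ‖T‖ ≤ 1) (x : E) :
    (fun k : ℤ => (inner ℂ x ((T ^ k.natAbs) x)).re) ∈ momentSpace (-1) 1 := by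
  rw [mem_momentSpace_iff]
  refine ⟨fun k => by rw [Int.natAbs_natCast], fun p hp => ?_⟩
  convert re_inner_aeval_nonneg T hT hT1 p hp x
  rw [momentFunctional_apply, aeval_def, eval₂_eq_sum, Polynomial.sum_def,
    sum_apply, inner_sum, Complex.re_sum]
  refine Finset.sum_congr rfl fun n _ => ?_
  rw [← Algebra.smul_def, smul_apply, inner_smul_right_eq_smul,
    Complex.smul_re, smul_eq_mul, mul_comm]
  simp

variable {S : Type*} [MeasurableSpace S] {π : Measure S}

/-- The operator on `L²(π)` with `⟪f, T g⟫ = ∫ conj (f x) * g y dμ(x, y)`, for a coupling `μ` of `π`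
with itself. -/
noncomputable def couplingOperator {μ : Measure (S × S)} (h₁ : MeasurePreserving Prod.fst μ π)
    (h₂ : MeasurePreserving Prod.snd μ π) : Lp ℂ 2 π →L[ℂ] Lp ℂ 2 π :=
  adjoint (Lp.compMeasurePreservingₗᵢ ℂ Prod.fst h₁).toContinuousLinearMap ∘L
    (Lp.compMeasurePreservingₗᵢ ℂ Prod.snd h₂).toContinuousLinearMap

section Coupling

variable {μ : Measure (S × S)} (h₁ : MeasurePreserving Prod.fst μ π)
    (h₂ : MeasurePreserving Prod.snd μ π)

theorem norm_couplingOperator_le : ‖couplingOperator h₁ h₂‖ ≤ 1 := by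
  refine (opNorm_comp_le _ _).trans ?_
  rw [LinearIsometryEquiv.norm_map]
  exact mul_le_one₀ (LinearIsometry.norm_toContinuousLinearMap_le _) (norm_nonneg _)
    (LinearIsometry.norm_toContinuousLinearMap_le _)

theorem inner_couplingOperator (f g : Lp ℂ 2 π) :
    inner ℂ f (couplingOperator h₁ h₂ g) = ∫ p, inner ℂ (f p.1) (g p.2) ∂μ := by
  rw [couplingOperator, comp_apply, adjoint_inner_right, L2.inner_def]
  refine integral_congr_ae ?_
  filter_upwards [Lp.coeFn_compMeasurePreserving f h₁, Lp.coeFn_compMeasurePreserving g h₂]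
    with p h h'
  exact congrArg₂ (inner ℂ) h h'

theorem isSelfAdjoint_couplingOperator (hμ : μ.map Prod.swap = μ) :
    IsSelfAdjoint (couplingOperator h₁ h₂) := by
  rw [ContinuousLinearMap.isSelfAdjoint_iff_isSymmetric]
  intro f g
  change inner ℂ (couplingOperator h₁ h₂ f) g = inner ℂ f (couplingOperator h₁ h₂ g)
  rw [← inner_conj_symm, inner_couplingOperator, inner_couplingOperator, ← integral_conj]
  simp only [inner_conj_symm]
  conv_rhs => rw [← hμ]
  exact (integral_map_equiv MeasurableEquiv.prodComm
    (fun p : S × S => inner ℂ (f p.1) (g p.2))).symm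

end Coupling

theorem measurePreserving_fst_compProd [IsProbabilityMeasure π] (κ : Kernel S S)
    [IsMarkovKernel κ] : MeasurePreserving Prod.fst (π ⊗ₘ κ) π :=
  ⟨measurable_fst, Measure.fst_compProd π κ⟩

theorem measurePreserving_snd_compProd [IsProbabilityMeasure π] {κ : Kernel S S}
    [IsMarkovKernel κ] (hκ : κ.Invariant π) : MeasurePreserving Prod.snd (π ⊗ₘ κ) π :=
  ⟨measurable_snd, (Measure.snd_compProd π κ).trans hκ⟩

/-- The Markov operator on `L²(π)` of a kernel that leaves `π` invariant. -/
noncomputable def markovOperator [IsProbabilityMeasure π] {κ : Kernel S S} [IsMarkovKernel κ]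
    (hκ : κ.Invariant π) : Lp ℂ 2 π →L[ℂ] Lp ℂ 2 π :=
  couplingOperator (measurePreserving_fst_compProd κ) (measurePreserving_snd_compProd hκ)

section Markov

variable [IsProbabilityMeasure π] {κ η : Kernel S S} [IsMarkovKernel κ] [IsMarkovKernel η]

theorem integrable_coeFn_Lp_two (g : Lp ℂ 2 π) : Integrable g π :=
  (Lp.memLp g).integrable one_le_two

/-- Both sides have the same integral over every measurable set, by pairing with indicators and
disintegrating `π ⊗ₘ κ`. -/
theorem markovOperator_ae_eq (hκ : κ.Invariant π) (g : Lp ℂ 2 π) :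
    markovOperator hκ g =ᵐ[π] fun x => ∫ y, g y ∂(κ x) := by
  have hint : Integrable (fun p : S × S => g p.2) (π ⊗ₘ κ) :=
    (measurePreserving_snd_compProd hκ).integrable_comp_of_integrable (integrable_coeFn_Lp_two g)
  have hint' : Integrable (fun x => ∫ y, g y ∂(κ x)) π := by
    simpa using Integrable.integral_compProd (κ := Kernel.const Unit π)
      (η := Kernel.prodMkLeft Unit κ) (a := ()) hint
  refine Integrable.ae_eq_of_forall_setIntegral_eq _ _ (integrable_coeFn_Lp_two _)
    hint' fun s hs hπs => ?_
  rw [← L2.inner_indicatorConstLp_one (𝕜 := ℂ) hs hπs.ne, markovOperator, inner_couplingOperator]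
  have key := Measure.setIntegral_compProd hs MeasurableSet.univ
    (hint.integrableOn (s := s ×ˢ Set.univ))
  simp only [Measure.restrict_univ] at key
  rw [← key, ← integral_indicator (hs.prod MeasurableSet.univ)]
  refine integral_congr_ae ?_
  filter_upwards [(measurePreserving_fst_compProd (π := π) κ).quasiMeasurePreserving.ae
    (indicatorConstLp_coeFn (p := 2) (hs := hs) (hμs := hπs.ne) (c := (1 : ℂ)))] with p hp
  rw [hp]
  by_cases hps : p.1 ∈ s <;> simp [Set.indicator, hps]

theorem markovOperator_comp (hκ : κ.Invariant π) (hη : η.Invariant π)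
    (h : (κ ∘ₖ η).Invariant π) :
    markovOperator h = markovOperator hη * markovOperator hκ := by
  ext1 g
  refine Lp.ext ?_
  -- Invariance under `η` turns a `π`-null set into one that is `η x`-null for `π`-almost every `x`.
  have h1 : ∀ᵐ x ∂π, ∀ᵐ y ∂(η x), markovOperator hκ g y = ∫ z, g z ∂(κ y) := by
    refine Measure.ae_ae_of_ae_comp ?_
    rw [hη.def]
    exact markovOperator_ae_eq hκ g
  have h2 : ∀ᵐ x ∂π, Integrable g ((κ ∘ₖ η) x) := by
    refine Measure.ae_integrable_of_integrable_comp ?_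
    rw [h.def]
    exact integrable_coeFn_Lp_two g
  filter_upwards [markovOperator_ae_eq h g, markovOperator_ae_eq hη (markovOperator hκ g), h1, h2]
    with x hx hx' hx1 hx2
  rw [mul_apply_eq_comp, hx, hx', Kernel.integral_comp hx2]
  exact (integral_congr_ae hx1).symm

end Markov

instance isMarkovKernel_pow (Q : Kernel S S) [IsMarkovKernel Q] (n : ℕ) :
    IsMarkovKernel (Q ^ n) := by
  induction n with
  | zero => exact inferInstanceAs (IsMarkovKernel (Kernel.id : Kernel S S))
  | succ n ih => exact inferInstanceAs (IsMarkovKernel ((Q ^ n) ∘ₖ Q))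

theorem invariant_pow {Q : Kernel S S} (hQ : Q.Invariant π) (n : ℕ) : (Q ^ n).Invariant π := by
  induction n with
  | zero => exact Measure.id_comp
  | succ n ih => exact ih.comp hQ

theorem markovOperator_pow [IsProbabilityMeasure π] {Q : Kernel S S} [IsMarkovKernel Q]
    (hQ : Q.Invariant π) (n : ℕ) :
    markovOperator (invariant_pow hQ n) = markovOperator hQ ^ n := by
  induction n with
  | zero =>
    ext1 g
    refine Lp.ext ((markovOperator_ae_eq _ g).trans (.of_forall fun x => ?_))
    change ∫ y, g y ∂(Kernel.id x) = g x
    rw [Kernel.id_apply, integral_dirac' _ _ (Lp.stronglyMeasurable g)]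
  | succ n ih =>
    rw [pow_succ' (markovOperator hQ), ← ih]
    exact markovOperator_comp (κ := Q ^ n) _ hQ (invariant_pow hQ (n + 1))

theorem compProd_map_swap_of_isReversible [IsProbabilityMeasure π] {Q : Kernel S S}
    [IsMarkovKernel Q] (hQ : Q.IsReversible π) : (π ⊗ₘ Q).map Prod.swap = π ⊗ₘ Q := by
  have : IsProbabilityMeasure ((π ⊗ₘ Q).map Prod.swap) :=
    Measure.isProbabilityMeasure_map measurable_swap.aemeasurable
  refine Measure.ext_prod fun {s t} hs ht => ?_
  rw [Measure.map_apply measurable_swap (hs.prod ht), Set.preimage_swap_prod,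
    Measure.compProd_apply_prod ht hs, Measure.compProd_apply_prod hs ht]
  exact hQ ht hs

theorem autocov_mem_momentSpace [IsProbabilityMeasure π] {Q : Kernel S S} [IsMarkovKernel Q]
    (hQ : Q.IsReversible π) {g : S → ℝ} (hg : MemLp g 2 π) :
    autocov Q π g ∈ momentSpace (-1) 1 := by
  have hg₀ : MemLp (fun x => ((g x - ∫ y, g y ∂π : ℝ) : ℂ)) 2 π :=
    (hg.sub (memLp_const _)).ofReal
  convert mem_momentSpace_of_inner_pow (markovOperator hQ.invariant)
    (isSelfAdjoint_couplingOperator _ _ (compProd_map_swap_of_isReversible hQ))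
    (norm_couplingOperator_le _ _) (hg₀.toLp _) using 1
  funext k
  have h₁ := measurePreserving_fst_compProd (π := π) (Q ^ k.natAbs)
  have h₂ := measurePreserving_snd_compProd (invariant_pow hQ.invariant k.natAbs)
  have e₁ : ∫ p, g p.1 ∂(π ⊗ₘ (Q ^ k.natAbs)) = ∫ y, g y ∂π := by
    conv_rhs => rw [← h₁.map_eq]
    rw [integral_map h₁.aemeasurable (by rw [h₁.map_eq]; exact hg.1)]
  have e₂ : ∫ p, g p.2 ∂(π ⊗ₘ (Q ^ k.natAbs)) = ∫ y, g y ∂π := by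
    conv_rhs => rw [← h₂.map_eq]
    rw [integral_map h₂.aemeasurable (by rw [h₂.map_eq]; exact hg.1)]
  rw [← markovOperator_pow, markovOperator, inner_couplingOperator, autocov, covariance, e₁, e₂,
    ← Complex.ofReal_re (∫ p, _ ∂_), ← integral_complex_ofReal]
  congr 1
  refine integral_congr_ae ?_
  filter_upwards [h₁.quasiMeasurePreserving.ae hg₀.coeFn_toLp,
    h₂.quasiMeasurePreserving.ae hg₀.coeFn_toLp] with p hp₁ hp₂
  rw [hp₁, hp₂]
  simp [mul_comm]

end SpectralRepresentation

/-! ### Projection in `ℓ²(ℤ)` and convergence of the asymptotic variance. -/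

section Projection

theorem summable_mul_of_summable_sq {ι : Type*} {x y : ι → ℝ} (hx : Summable fun k => x k ^ 2)
    (hy : Summable fun k => y k ^ 2) : Summable fun k => x k * y k :=
  Summable.of_norm_bounded (hx.add hy) fun k => by
    rw [Real.norm_eq_abs, abs_le]
    constructor <;> nlinarith [sq_nonneg (x k + y k), sq_nonneg (x k - y k)]

theorem summable_sub_sq {ι : Type*} {x y : ι → ℝ} (hx : Summable fun k => x k ^ 2)
    (hy : Summable fun k => y k ^ 2) : Summable fun k => (x k - y k) ^ 2 := by
  refine ((hx.add hy).sub ((summable_mul_of_summable_sq hx hy).mul_left 2)).congr fun k => ?_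
  ring

/-- Moment sequences on `[-1 + δ, 1 - δ]` are uniformly dominated, up to their value at `0`, by a
summable sequence. -/
theorem exists_summable_bound {δ : ℝ} (hδ : 0 < δ) :
    ∃ w : ℤ → ℝ, Summable w ∧ (∀ k, 0 ≤ w k) ∧ (∀ k, w k ≤ 1) ∧
      ∀ m ∈ momentSpace (-1 + δ) (1 - δ), ∀ k, |m k| ≤ m 0 * w k := by
  rcases le_or_gt δ 1 with h | h
  · have h0 : |1 - δ| < 1 := by rw [abs_lt]; constructor <;> linarith
    refine ⟨fun k => |1 - δ| ^ k.natAbs, ?_, fun k => by positivity,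
      fun k => pow_le_one₀ (abs_nonneg _) h0.le, fun m hm k => abs_le_of_mem_momentSpace hm k⟩
    have hs := summable_geometric_of_lt_one (abs_nonneg _) h0
    exact Summable.of_nat_of_neg (by simpa using hs) (by simpa using hs)
  -- The interval is empty here; the geometric weight would fail to be summable for `δ ≥ 2`.
  · refine ⟨fun _ => 0, summable_zero, fun _ => le_rfl, fun _ => zero_le_one, fun m hm k => ?_⟩
    simp [eq_zero_of_mem_momentSpace h hm]

theorem summable_of_mem_momentSpace {δ : ℝ} (hδ : 0 < δ) {m : ℤ → ℝ}
    (hm : m ∈ momentSpace (-1 + δ) (1 - δ)) : Summable m := by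
  obtain ⟨w, hw, -, -, hmw⟩ := exists_summable_bound hδ
  exact Summable.of_norm_bounded (hw.mul_left _) (hmw m hm)

/-- Geometric decay makes square summability automatic. -/
theorem momentSpaceL2_eq {δ : ℝ} (hδ : 0 < δ) :
    momentSpaceL2 δ = momentSpace (-1 + δ) (1 - δ) := by
  refine Set.Subset.antisymm (fun m hm => hm.1) fun m hm => ⟨hm, ?_⟩
  obtain ⟨w, hw, hw0, hw1, hmw⟩ := exists_summable_bound hδ
  refine Summable.of_norm_bounded (hw.mul_left (m 0 ^ 2)) fun k => ?_
  rw [Real.norm_eq_abs, abs_pow]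
  refine (pow_le_pow_left₀ (abs_nonneg _) (hmw m hm k) 2).trans ?_
  rw [mul_pow]
  exact mul_le_mul_of_nonneg_left (pow_le_of_le_one (hw0 k) (hw1 k) two_ne_zero) (sq_nonneg _)

theorem memℓp_two_iff {x : ℤ → ℝ} : Memℓp x 2 ↔ Summable fun k => x k ^ 2 := by
  rw [memℓp_gen_iff (by simp)]
  simp

theorem real_inner_lp_two (x y : lp (fun _ : ℤ => ℝ) 2) : inner ℝ x y = ∑' k, x k * y k := by
  rw [lp.inner_eq_tsum]
  simp [mul_comm]

theorem norm_sq_lp_two (x : lp (fun _ : ℤ => ℝ) 2) : ‖x‖ ^ 2 = ∑' k, x k ^ 2 := by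
  rw [← real_inner_self_eq_norm_sq, real_inner_lp_two]
  simp [sq]

/-- The moment sequences, as a subset of the Hilbert space `ℓ²(ℤ)`. -/
def momentSetLp (δ : ℝ) : Set (lp (fun _ : ℤ => ℝ) 2) := {x | ⇑x ∈ momentSpaceL2 δ}

theorem convex_momentSetLp {δ : ℝ} (hδ : 0 < δ) : Convex ℝ (momentSetLp δ) := by
  intro x hx y hy s t hs ht hst
  simp only [momentSetLp, momentSpaceL2_eq hδ, Set.mem_ofPred_eq] at hx hy ⊢
  exact convex_momentSpace _ _ hx hy hs ht hst

theorem isClosed_momentSetLp {δ : ℝ} (hδ : 0 < δ) : IsClosed (momentSetLp δ) := by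
  refine IsSeqClosed.isClosed fun u x hu hx => ?_
  simp only [momentSetLp, momentSpaceL2_eq hδ, Set.mem_ofPred_eq] at hu ⊢
  refine mem_momentSpace_of_tendsto (l := atTop) hu fun k => ?_
  exact ((lp.evalCLM ℝ (fun _ : ℤ => ℝ) 2 k).continuous.tendsto x).comp hx

theorem isProjection_iff {δ : ℝ} (x y : lp (fun _ : ℤ => ℝ) 2) :
    IsProjection δ x y ↔ y ∈ momentSetLp δ ∧ ‖x - y‖ = ⨅ z : momentSetLp δ, ‖x - z‖ := by
  have hd : ∀ z : lp (fun _ : ℤ => ℝ) 2, ∑' k, (x k - z k) ^ 2 = ‖x - z‖ ^ 2 := fun z => by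
    rw [norm_sq_lp_two]; rfl
  have hbdd : BddBelow (Set.range fun z : momentSetLp δ => ‖x - z‖) :=
    ⟨0, by rintro _ ⟨z, rfl⟩; exact norm_nonneg _⟩
  refine and_congr_right fun hy => ⟨fun h => ?_, fun h m hm => ?_⟩
  · have : Nonempty (momentSetLp δ) := ⟨⟨y, hy⟩⟩
    refine le_antisymm (le_ciInf fun z => ?_) (ciInf_le hbdd ⟨y, hy⟩)
    have := h z.2
    simp only [Set.mem_ofPred_eq, hd] at this
    exact le_of_sq_le_sq this (norm_nonneg _)
  · have := ciInf_le hbdd ⟨⟨m, memℓp_two_iff.2 hm.2⟩, hm⟩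
    rw [← h] at this
    have := pow_le_pow_left₀ (norm_nonneg _) this 2
    rwa [← hd, ← hd] at this

/-- A least squares projection onto the moment sequences exists. -/
theorem isProjection_momentLSE {δ : ℝ} (hδ : 0 < δ) {r : ℤ → ℝ} (hr : Summable fun k => r k ^ 2) :
    IsProjection δ r (momentLSE δ r) := by
  refine Classical.epsilon_spec (p := IsProjection δ r) ?_
  let x : lp (fun _ : ℤ => ℝ) 2 := ⟨r, memℓp_two_iff.2 hr⟩
  have h0 : (momentSetLp δ).Nonempty := by
    refine ⟨0, ?_⟩
    simp only [momentSetLp, momentSpaceL2_eq hδ, Set.mem_ofPred_eq]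
    exact zero_mem_momentSpace _ _
  obtain ⟨y, hy, h⟩ := exists_norm_eq_iInf_of_complete_convex h0
    (isClosed_momentSetLp hδ).isComplete (convex_momentSetLp hδ) x
  exact ⟨y, (isProjection_iff x y).2 ⟨hy, h⟩⟩

/-- The variational inequality of a projection onto a convex set. -/
theorem IsProjection.tsum_mul_nonpos {δ : ℝ} (hδ : 0 < δ) {r m m' : ℤ → ℝ}
    (hr : Summable fun k => r k ^ 2) (h : IsProjection δ r m) (hm' : m' ∈ momentSpaceL2 δ) :
    ∑' k, (r k - m k) * (m' k - m k) ≤ 0 := by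
  let x : lp (fun _ : ℤ => ℝ) 2 := ⟨r, memℓp_two_iff.2 hr⟩
  let y : lp (fun _ : ℤ => ℝ) 2 := ⟨m, memℓp_two_iff.2 h.1.2⟩
  let z : lp (fun _ : ℤ => ℝ) 2 := ⟨m', memℓp_two_iff.2 hm'.2⟩
  have key := (norm_eq_iInf_iff_real_inner_le_zero (convex_momentSetLp hδ) h.1).1
    ((isProjection_iff x y).1 h).2 z hm'
  rwa [real_inner_lp_two] at key

/-- The variational inequality tested at `0`. -/
theorem IsProjection.sum_sq_le {δ : ℝ} (hδ : 0 < δ) {r m : ℤ → ℝ}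
    (hr : Summable fun k => r k ^ 2) (h : IsProjection δ r m) :
    ∑' k, m k ^ 2 ≤ ∑' k, r k * m k := by
  have h0 : (0 : ℤ → ℝ) ∈ momentSpaceL2 δ := by
    rw [momentSpaceL2_eq hδ]
    exact zero_mem_momentSpace _ _
  have key := h.tsum_mul_nonpos hδ hr h0
  have e : ∀ k, (r k - m k) * ((0 : ℤ → ℝ) k - m k) = m k ^ 2 - r k * m k := fun k => by
    simp only [Pi.zero_apply]; ring
  simp only [e] at key
  rw [h.1.2.tsum_sub (summable_mul_of_summable_sq hr h.1.2)] at key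
  linarith

/-- The variational inequality tested at `γ`. -/
theorem IsProjection.sum_sub_sq_le {δ : ℝ} (hδ : 0 < δ) {r m γ : ℤ → ℝ}
    (hr : Summable fun k => r k ^ 2) (h : IsProjection δ r m) (hγ : γ ∈ momentSpaceL2 δ) :
    ∑' k, (m k - γ k) ^ 2 ≤ ∑' k, (r k - γ k) * (m k - γ k) := by
  have key := h.tsum_mul_nonpos hδ hr hγ
  have e : ∀ k, (r k - m k) * (γ k - m k) = (m k - γ k) ^ 2 - (r k - γ k) * (m k - γ k) :=
    fun k => by ring
  simp only [e] at key
  have hs := summable_sub_sq h.1.2 hγ.2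
  rw [hs.tsum_sub (summable_mul_of_summable_sq (summable_sub_sq hr hγ.2) hs)] at key
  linarith

/-- Pointwise consistency of peaked inputs implies consistency of the asymptotic variance of their
projections. -/
theorem tendsto_asympVar_of_isProjection {δ : ℝ} (hδ : 0 < δ) {γ : ℤ → ℝ}
    (hγ : γ ∈ momentSpaceL2 δ) {r m : ℕ → ℤ → ℝ} (hr : ∀ M, Summable fun k => r M k ^ 2)
    (hpeak : ∀ M k, |r M k| ≤ r M 0) (hlim : ∀ k, Tendsto (fun M => r M k) atTop (𝓝 (γ k)))
    (hm : ∀ M, IsProjection δ (r M) (m M)) :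
    Tendsto (fun M => asympVar (m M)) atTop (𝓝 (asympVar γ)) := by
  obtain ⟨w, hw, hw0, -, hmw⟩ := exists_summable_bound hδ
  set W := ∑' k, w k with hW
  have hW0 : 0 ≤ W := tsum_nonneg hw0
  have hm0 : ∀ M, 0 ≤ m M 0 := fun M => zero_le_of_mem_momentSpace (hm M).1.1
  have hγ0 : 0 ≤ γ 0 := zero_le_of_mem_momentSpace hγ.1
  have hr0 : ∀ M, 0 ≤ r M 0 := fun M => (abs_nonneg _).trans (hpeak M 0)
  have hmW : ∀ M, m M 0 ≤ r M 0 * W := by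
    intro M
    have h1 : m M 0 ^ 2 ≤ ∑' k, m M k ^ 2 :=
      (hm M).1.2.le_tsum 0 fun k _ => sq_nonneg _
    have h2 : ∑' k, r M k * m M k ≤ r M 0 * (m M 0 * W) := by
      rw [hW, ← tsum_mul_left, ← tsum_mul_left]
      refine (summable_mul_of_summable_sq (hr M) (hm M).1.2).tsum_le_tsum (fun k => ?_)
        ((hw.mul_left _).mul_left _)
      refine (le_abs_self _).trans ?_
      rw [abs_mul]
      exact mul_le_mul (hpeak M k) (hmw _ (hm M).1.1 k) (abs_nonneg _) (hr0 M)
    have h3 := (hm M).sum_sq_le hδ (hr M)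
    -- The estimates combine to `(m M 0)² ≤ r M 0 * m M 0 * W`; cancel `m M 0` when it is positive.
    rcases (hm0 M).eq_or_lt with h | h
    · rw [← h]
      exact mul_nonneg (hr0 M) hW0
    · nlinarith
  have hev : ∀ᶠ M in atTop, r M 0 ≤ γ 0 + 1 :=
    ((hlim 0).eventually_lt_const (lt_add_one _)).mono fun M h => h.le
  set B := (γ 0 + 1) * W with hB
  have hmB : ∀ᶠ M in atTop, m M 0 ≤ B := hev.mono fun M h =>
    (hmW M).trans (mul_le_mul_of_nonneg_right h hW0)
  have hB0 : 0 ≤ B := by positivity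
  have hmk : ∀ᶠ M in atTop, ∀ k, |m M k| ≤ B * w k := hmB.mono fun M h k =>
    (hmw _ (hm M).1.1 k).trans (mul_le_mul_of_nonneg_right h (hw0 k))
  have hcross : Tendsto (fun M => ∑' k, (r M k - γ k) * (m M k - γ k)) atTop (𝓝 0) := by
    have hbd : ∀ᶠ M in atTop, ∀ k, |m M k - γ k| ≤ (B + γ 0) * w k := hmk.mono fun M h k => by
      rw [add_mul]
      exact (abs_sub _ _).trans (add_le_add (h k) (hmw _ hγ.1 k))
    rw [← tsum_zero (α := ℝ) (β := ℤ)]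
    refine tendsto_tsum_of_dominated_convergence
      (bound := fun k => (γ 0 + 1 + γ 0) * ((B + γ 0) * w k))
      ((hw.mul_left _).mul_left _) (fun k => ?_) ?_
    · refine (bdd_le_mul_tendsto_zero' ((B + γ 0) * w k) (hbd.mono fun M h => h k) ?_).congr
        fun M => mul_comm _ _
      simpa using (hlim k).sub_const (γ k)
    · filter_upwards [hev, hbd] with M h1 h2 k
      rw [norm_mul]
      refine mul_le_mul ?_ (h2 k) (norm_nonneg _) (by positivity)
      have h3 : |γ k| ≤ γ 0 := by
        refine le_of_tendsto_of_tendsto' (hlim k).abs (hlim 0) fun M => hpeak M k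
      exact (abs_sub _ _).trans (add_le_add ((hpeak M k).trans h1) h3)
  have hpt : ∀ k, Tendsto (fun M => m M k) atTop (𝓝 (γ k)) := by
    intro k
    rw [← tendsto_sub_nhds_zero_iff]
    have hsq : Tendsto (fun M => (m M k - γ k) ^ 2) atTop (𝓝 0) :=
      squeeze_zero (fun M => sq_nonneg _) (fun M =>
        ((summable_sub_sq (hm M).1.2 hγ.2).le_tsum k fun j _ => sq_nonneg _).trans
          ((hm M).sum_sub_sq_le hδ (hr M) hγ)) hcross
    rw [tendsto_zero_iff_abs_tendsto_zero]
    simpa [Real.sqrt_sq_eq_abs, Function.comp_def] using hsq.sqrt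
  exact tendsto_tsum_of_dominated_convergence (hw.mul_left B) hpt hmk

end Projection

theorem IsInitialEstimator.summable_sq {S Ω : Type*} [MeasurableSpace S] [MeasurableSpace Ω]
    {P : Measure Ω} {X : ℕ → Ω → S} {γ : ℤ → ℝ} {r : (M : ℕ) → (Fin M → S) → ℤ → ℝ}
    (hr : IsInitialEstimator P X γ r) (M : ℕ) (z : Fin M → S) :
    Summable fun k => r M z k ^ 2 := by
  obtain ⟨n, hn⟩ := hr.finite_support M z
  refine summable_of_ne_finset_zero (s := Finset.Ioo (-(n : ℤ)) n) fun k hk => ?_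
  have : r M z k = 0 := by
    rcases le_or_gt (n : ℤ) k with h | h
    · exact hn k h
    · rw [hr.even]
      refine hn _ ?_
      by_contra h'
      exact hk (Finset.mem_Ioo.2 ⟨by omega, h⟩)
  simp [this]

end MomentLSE

/-! ### Strong consistency. -/

theorem mainTheorem2
    {S : Type*} [MetricSpace S] [CompleteSpace S] [TopologicalSpace.SeparableSpace S]
    [MeasurableSpace S] [BorelSpace S]
    {Ω : Type*} [MeasurableSpace Ω] (P : Measure Ω) [IsProbabilityMeasure P]
    (π ψ : Measure S) [IsProbabilityMeasure π] [IsProbabilityMeasure ψ]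
    (Q : Kernel S S) [IsMarkovKernel Q]
    (hrev : Q.IsReversible π)
    (hirr : MomentLSE.IsPsiIrreducible ψ Q)
    (hdrift : MomentLSE.GeometricDrift Q)
    (haper : MomentLSE.IsAperiodic ψ Q)
    (X : ℕ → Ω → S) (hX : MomentLSE.IsMarkovChain P Q X)
    (g : S → ℝ) (hg : MemLp g 2 π)
    (δ : ℝ) (hδ : 0 < δ)
    (hF : ∀ (a b : ℝ) (F : Measure ℝ),
      MomentLSE.IsRepresentingMeasure a b (MomentLSE.autocov Q π g) F →
        F.support ⊆ Set.Icc (-1 + δ) (1 - δ))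
    (r : (M : ℕ) → (Fin M → S) → ℤ → ℝ)
    (hr : MomentLSE.IsInitialEstimator P X (MomentLSE.autocov Q π g) r) :
    Summable (MomentLSE.autocov Q π g) ∧
    (∀ (M : ℕ) (ω : Ω), Summable (MomentLSE.momentLSE δ (r M fun i => X i ω))) ∧
    ∀ᵐ ω ∂P, Tendsto
      (fun M : ℕ => MomentLSE.asympVar (MomentLSE.momentLSE δ (r M fun i => X i ω)))
      atTop (𝓝 (MomentLSE.asympVar (MomentLSE.autocov Q π g))) := by
  have hγ₁ := MomentLSE.autocov_mem_momentSpace hrev hg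
  have hγ : MomentLSE.autocov Q π g ∈ MomentLSE.momentSpace (-1 + δ) (1 - δ) := by
    obtain ⟨F, hF₁⟩ := hγ₁
    -- The support hypothesis covers every representing measure, in particular the one found on
    -- `[-1, 1]`.
    exact ⟨F, hF₁.finite, hF _ _ F hF₁, hF₁.moment⟩
  have hproj : ∀ M (z : Fin M → S),
      MomentLSE.IsProjection δ (r M z) (MomentLSE.momentLSE δ (r M z)) := fun M z =>
    MomentLSE.isProjection_momentLSE hδ (hr.summable_sq M z)
  refine ⟨MomentLSE.summable_of_mem_momentSpace hδ hγ, fun M ω =>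
    MomentLSE.summable_of_mem_momentSpace hδ (hproj M _).1.1, ?_⟩
  -- There are countably many lags, so one null set serves them all; the rest is deterministic.
  filter_upwards [ae_all_iff.2 hr.tendsto_ae] with ω hω
  refine MomentLSE.tendsto_asympVar_of_isProjection hδ ?_ (fun M => hr.summable_sq M _)
    (fun M => hr.peak M _) hω (fun M => hproj M _)
  rw [MomentLSE.momentSpaceL2_eq hδ]
  exact hγ
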